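/- Lemma 1.18 (Lemma on Odd Wheels). All graphs are finite. For a set $X$ of vertices of a graph $G$, let $\partial(X)$ be the cut consisting of the edges with exactly one end in $X$, and write $\partial(v)=\partial(\{v\})$; the cut $\partial(X)$ is trivial if $X$ or its complement $\overline{X}$ has exactly one vertex. Let $G/X$ be the graph obtained from $G$ by shrinking $X$ to a single vertex and deleting the resulting loops. A graph is matching covered if it is connected, has at least two vertices, and each of its edges lies in a perfect matching. In a matching covered graph $G$, a cut $\partial(X)$ is separating if both $G/X$ and $G/\overline{X}$ are matching covered, and tight if $|\partial(X)\cap M|=1$ for every perfect matching $M$ of $G$. A brick is a nonbipartite matching covered graph without nontrivial tight cuts; a matching covered graph is solid if each of its separating cuts is tight. An edge $e$ of a matching covered graph $G$ is removable if $G-e$ is matching covered. For a vertex $v_0$ of $G$, a $v_0$-matching is a set $M$ of edges of $G$ such that $|M\cap\partial(v)|=1$ for each vertex $v\neq v_0$ and $|M\cap\partial(v_0)|>1$. For odd $k\ge 3$, the odd wheel $W_k$ is the join of the cycle $C_k$ and a single vertex, called a hub (in $W_3\cong K_4$ each of the four vertices is regarded as a hub). Let $G$ be a simple solid brick, let $v_0$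 be a vertex of $G$, and let $M_0$ be a $v_0$-matching of $G$. Then $G$ is an odd wheel having $v_0$ as a hub, or $G$ has a removable edge $e\notin M_0\cup\partial(v_0)$. -/

import Mathlib

namespace OddWheelLemma

open SimpleGraph

/-- A graph is *matching covered* if it is connected, has at least two vertices, and each of its
edges is admissible, i.e. lies in some perfect matching. -/
def IsMatchingCovered {V : Type*} (G : SimpleGraph V) : Prop :=
  G.Connected ∧ Nontrivial V ∧
    ∀ e ∈ G.edgeSet, ∃ M : G.Subgraph, M.IsPerfectMatching ∧ e ∈ M.edgeSet

/-- The cut `∂(X)`: the set of edges of `G` with one end in `X` and the other end outside `X`. -/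
def cut {V : Type*} (G : SimpleGraph V) (X : Set V) : Set (Sym2 V) :=
  {e | ∃ x ∈ X, ∃ y ∉ X, G.Adj x y ∧ e = s(x, y)}

/-- The cut `∂(X)` is *trivial* if one of its shores `X`, `Xᶜ` has exactly one vertex. -/
def IsTrivialCut {V : Type*} (X : Set V) : Prop :=
  X.ncard = 1 ∨ Xᶜ.ncard = 1

open Classical in
/-- The map that sends all of `X` to the contraction vertex `none` and fixes all other vertices. -/
noncomputable def shrink {V : Type*} (X : Set V) (v : V) : Option {v : V // v ∉ X} :=
  if h : v ∈ X then none else some ⟨v, h⟩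

/-- The contraction `G / X`: the set `X` is shrunk to the single vertex `none` and the resulting
loops are deleted (`SimpleGraph.map` deletes loops). Edges that become parallel are identified.
The contraction is used below only through the property of being matching covered, which does not
depend on the multiplicity of edges: connectedness does not, and in a perfect matching an edge can
be replaced by any edge parallel to it. -/
noncomputable def contract {V : Type*} (G : SimpleGraph V) (X : Set V) :
    SimpleGraph (Option {v : V // v ∉ X}) :=
  G.map (shrink X)

/-- The cut `∂(X)` is *separating* if both of its cut-contractions are matching covered.
(This forces `X` and `Xᶜ` to have odd cardinality when `V` is finite.) -/
def IsSeparatingCut {V : Type*} (G : SimpleGraph V) (X : Set V) : Prop :=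
  IsMatchingCovered (contract G X) ∧ IsMatchingCovered (contract G Xᶜ)

/-- The cut `∂(X)` is *tight* if every perfect matching has exactly one edge in it. -/
def IsTightCut {V : Type*} (G : SimpleGraph V) (X : Set V) : Prop :=
  ∀ M : G.Subgraph, M.IsPerfectMatching → (cut G X ∩ M.edgeSet).ncard = 1

/-- A *brick* is a nonbipartite matching covered graph free of nontrivial tight cuts. -/
def IsBrick {V : Type*} (G : SimpleGraph V) : Prop :=
  IsMatchingCovered G ∧ ¬ G.IsBipartite ∧ ∀ X : Set V, IsTightCut G X → IsTrivialCut X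

/-- A matching covered graph is *solid* if each of its separating cuts is tight. -/
def IsSolid {V : Type*} (G : SimpleGraph V) : Prop :=
  IsMatchingCovered G ∧ ∀ X : Set V, IsSeparatingCut G X → IsTightCut G X

/-- `M` is a *`v₀`-matching* of `G`: a set of edges of which exactly one is incident with each
vertex other than `v₀`, and more than one is incident with `v₀`. -/
def IsVertexMatching {V : Type*} (G : SimpleGraph V) (v₀ : V) (M : Set (Sym2 V)) : Prop :=
  M ⊆ G.edgeSet ∧ (∀ v, v ≠ v₀ → (M ∩ G.incidenceSet v).ncard = 1) ∧
    1 < (M ∩ G.incidenceSet v₀).ncard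

/-- An edge `e` of a matching covered graph `G` is *removable* if `G - e` is matching covered. -/
def IsRemovable {V : Type*} (G : SimpleGraph V) (e : Sym2 V) : Prop :=
  e ∈ G.edgeSet ∧ IsMatchingCovered (G.deleteEdges {e})

/-- The wheel `W_k`: the join of the cycle `C_k` (the rim, vertices `some i`) and a single vertex
(the hub, `none`). -/
def wheel (k : ℕ) : SimpleGraph (Option (Fin k)) where
  Adj
    | some i, some j => (cycleGraph k).Adj i j
    | some _, none => True
    | none, some _ => True
    | none, none => False
  symm.symm
    | some _, some _ => fun h => h.symm
    | some _, none => id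
    | none, some _ => id
    | none, none => id
  loopless.irrefl
    | some _ => (cycleGraph k).irrefl
    | none => id

/-- `G` is an odd wheel having `v₀` as a hub. (In `W_3 = K_4` every vertex can be the hub.) -/
def IsOddWheelWithHub {V : Type*} (G : SimpleGraph V) (v₀ : V) : Prop :=
  ∃ k : ℕ, Odd k ∧ 3 ≤ k ∧ ∃ φ : G ≃g wheel k, φ v₀ = none

end OddWheelLemma

namespace OddWheelLemma

open SimpleGraph Finset

/-! The engine is polyhedral. In a solid brick every fractional perfect matching satisfies all odd
cut constraints: on the segment from the average of all perfect matchings to a violating point, the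
first violated cut to reach weight one is separating, hence tight, hence trivial; but a trivial cut
has weight one in every fractional perfect matching. With Tutte's theorem, each edge of the support
then lies in a perfect matching inside the support (`IsFractional.exists_isMate_of_isSolid`). So `G
- e` need only be covered by half-integral solutions, which Hall's theorem supplies unless there is
an obstruction: a set `I` spanning only `e`, with at most `#I` outside neighbours
(`exists_obstruction`).

If `e ∉ M₀`, then `M₀` sends `I` outside `I`, with a neighbour to spare if `v₀ ∈ I`; hence `v₀ ∉ I`.
Suppose that `xy` and `xb` avoid `M₀` and `v₀` and are not removable. Uncrossing their obstructions,
against the fact that a nonempty stable set `S` of a brick has at least `#S + 2` neighbours, leaves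
`x` no neighbours but `y`, `b`, `v₀`. As `M₀` has one edge at `x` and `x` has degree at least three,
absence of suitable removable edges makes every `x ≠ v₀` cubic and adjacent to `v₀`. Then `G - v₀`
is 2-regular, and parity forces a single odd cycle. -/

/-- A perfect matching of `G`, given as the fixed-point-free involution that sends each vertex to
its partner. -/
def IsMate {V : Type*} (G : SimpleGraph V) (m : V → V) : Prop :=
  ∀ a, G.Adj a (m a) ∧ m (m a) = a

/-! ### Perfect matchings as involutions; Tutte's theorem -/

section Mate

variable {V : Type*} {G : SimpleGraph V}

theorem IsMate.injective {m : V → V} (hm : IsMate G m) : Function.Injective m :=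
  Function.LeftInverse.injective (g := m) fun a => (hm a).2

theorem IsMate.ne {m : V → V} (hm : IsMate G m) (a : V) : m a ≠ a := fun h =>
  G.irrefl (v := a) (by simpa [h] using (hm a).1)

/-- The subgraph formed by the edges of a perfect matching given as an involution. -/
def IsMate.subgraph {m : V → V} (hm : IsMate G m) : G.Subgraph where
  verts := Set.univ
  Adj a b := m a = b
  adj_sub := by rintro a _ rfl; exact (hm a).1
  edge_vert _ := Set.mem_univ _
  symm.symm := by rintro a _ rfl; exact (hm a).2

theorem IsMate.subgraph_isPerfectMatching {m : V → V} (hm : IsMate G m) :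
    hm.subgraph.IsPerfectMatching :=
  ⟨fun a _ => ⟨m a, rfl, fun _ (h : m a = _) => h.symm⟩, fun _ => Set.mem_univ _⟩

theorem exists_isMate_of_isPerfectMatching {M : G.Subgraph} (hM : M.IsPerfectMatching) :
    ∃ m, IsMate G m ∧ ∀ a b, M.Adj a b ↔ m a = b := by
  choose m hm hu using fun a => hM.1 (hM.2 a)
  have h : ∀ a b, M.Adj a b ↔ m a = b :=
    fun a b => ⟨fun h => (hu a b h).symm, by rintro rfl; exact hm a⟩
  exact ⟨m, fun a => ⟨(hm a).adj_sub, (h _ _).1 (hm a).symm⟩, h⟩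

theorem IsMatchingCovered.exists_isMate (h : IsMatchingCovered G) {a b : V} (hab : G.Adj a b) :
    ∃ m, IsMate G m ∧ m a = b := by
  obtain ⟨M, hM, he⟩ := h.2.2 s(a, b) hab
  obtain ⟨m, hm, hm'⟩ := exists_isMate_of_isPerfectMatching hM
  exact ⟨m, hm, (hm' a b).1 he⟩

theorem isMatchingCovered_of_isMate [Nontrivial V] (hc : G.Connected)
    (h : ∀ a b, G.Adj a b → ∃ m, IsMate G m ∧ m a = b) : IsMatchingCovered G := by
  refine ⟨hc, inferInstance, fun e => ?_⟩
  induction e with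
  | _ a b =>
    intro hab
    obtain ⟨m, hm, hmab⟩ := h a b hab
    exact ⟨hm.subgraph, hm.subgraph_isPerfectMatching, hmab⟩

theorem isTightCut_of_isMate {X : Set V}
    (h : ∀ m, IsMate G m → ∃ a ∈ X, m a ∉ X ∧ ∀ b ∈ X, m b ∉ X → b = a) : IsTightCut G X := by
  intro M hM
  obtain ⟨m, hm, hm'⟩ := exists_isMate_of_isPerfectMatching hM
  obtain ⟨a, haX, hma, hu⟩ := h m hm
  rw [Set.ncard_eq_one]
  refine ⟨s(a, m a), Set.eq_singleton_iff_unique_mem.2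
    ⟨⟨⟨a, haX, m a, hma, (hm a).1, rfl⟩, (hm' _ _).2 rfl⟩, ?_⟩⟩
  rintro _ ⟨⟨x, hx, y, hy, -, rfl⟩, h2⟩
  obtain rfl : m x = y := (hm' _ _).1 h2
  rw [hu x hx hy]

theorem even_card_of_isMate [DecidableEq V] {m : V → V} (hm : IsMate G m) {X : Finset V}
    (hX : ∀ a ∈ X, m a ∈ X) : Even #X := by
  have h : ∑ _a ∈ X, (1 : ZMod 2) = 0 :=
    Finset.sum_involution (fun a _ => m a) (fun _ _ => by decide)
      (fun a _ _ => hm.ne a) (fun a ha => hX a ha) (fun a _ => (hm a).2)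
  simpa [ZMod.natCast_eq_zero_iff_even] using h

theorem IsMate.exists_of_odd [DecidableEq V] {m : V → V} (hm : IsMate G m)
    {X : Finset V} (hX : Odd #X) :
    ∃ a ∈ X, m a ∉ X := by
  by_contra! h
  exact Nat.not_even_iff_odd.2 hX (even_card_of_isMate hm h)

theorem even_card [Fintype V] [DecidableEq V] {m : V → V} (hm : IsMate G m) :
    Even (Fintype.card V) := even_card_of_isMate hm (X := univ) (by simp)

/-- Tutte's theorem, stated with disjoint vertex sets in place of components. -/
theorem exists_odd_family [Fintype V] [DecidableEq V] (heven : Even (Fintype.card V))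
    (h : ¬ ∃ m, IsMate G m) :
    ∃ (U : Finset V) (𝒞 : Finset (Finset V)), #U + 2 ≤ #𝒞 ∧
      (𝒞 : Set (Finset V)).PairwiseDisjoint id ∧
      ∀ C ∈ 𝒞, Odd #C ∧ Disjoint C U ∧ ∀ a ∈ C, ∀ b, G.Adj a b → b ∈ C ∨ b ∈ U := by
  classical
  have hM : ∀ M : G.Subgraph, ¬ M.IsPerfectMatching := fun M hM =>
    let ⟨m, hm, _⟩ := exists_isMate_of_isPerfectMatching hM
    h ⟨m, hm⟩
  obtain ⟨u, hu⟩ : ∃ u, G.IsTutteViolator u := by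
    by_contra hcon
    push Not at hcon
    obtain ⟨M, hM'⟩ := tutte.2 hcon
    exact hM M hM'
  unfold IsTutteViolator at hu
  set K := ((⊤ : G.Subgraph).deleteVerts u).coe with hK
  have hpar := K.odd_ncard_oddComponents
  have hcard : Nat.card ((⊤ : G.Subgraph).deleteVerts u).verts + u.ncard = Fintype.card V := by
    have : ((⊤ : G.Subgraph).deleteVerts u).verts = uᶜ := by ext; simp
    rw [this, Nat.card_coe_set_eq, add_comm, Set.ncard_add_ncard_compl, Nat.card_eq_fintype_card]
  -- A Tutte violator has an excess of at least one; as `V` is even, `u` and the number of odd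
  -- components agree in parity, so the excess is at least two.
  have hge : u.ncard + 2 ≤ K.oddComponents.ncard := by
    rcases Nat.even_or_odd (K.oddComponents.ncard) with h1 | h1 <;>
    [have h2 := Nat.not_odd_iff_even.1 (fun h => Nat.not_odd_iff_even.2 h1 (hpar.2 h));
     have h2 := hpar.1 h1]
    all_goals
      by_contra hlt
      have : K.oddComponents.ncard = u.ncard + 1 := by omega
      grind
  let F : K.ConnectedComponent → Finset V := fun c => (Subtype.val '' c.supp).toFinset
  have hF : ∀ c x, x ∈ F c ↔ ∃ hx, (⟨x, hx⟩ : ((⊤ : G.Subgraph).deleteVerts u).verts) ∈ c.supp := by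
    intro c x
    simp [F]
  have hdisj : ∀ c d x, x ∈ F c → x ∈ F d → c = d := by
    intro c d x hc hd
    obtain ⟨_, hc⟩ := (hF _ _).1 hc
    obtain ⟨_, hd⟩ := (hF _ _).1 hd
    rw [ConnectedComponent.mem_supp_iff] at hc hd
    exact hc.symm.trans hd
  have hcardF : ∀ c, #(F c) = c.supp.ncard := by
    intro c
    rw [← Set.ncard_eq_toFinset_card', Set.ncard_image_of_injective _ Subtype.val_injective]
  have hne : ∀ c, (F c).Nonempty := by
    intro c
    obtain ⟨x, hx⟩ := c.nonempty_supp
    exact ⟨x.1, (hF _ _).2 ⟨x.2, hx⟩⟩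
  have hFinj : Function.Injective F := by
    intro c d hcd
    obtain ⟨x, hx⟩ := hne c
    exact hdisj c d x hx (hcd ▸ hx)
  refine ⟨u.toFinset, K.oddComponents.toFinset.image F, ?_, ?_, ?_⟩
  · rw [card_image_of_injective _ hFinj, ← Set.ncard_eq_toFinset_card',
      ← Set.ncard_eq_toFinset_card']
    exact hge
  · intro C hC D hD hCD
    simp only [coe_image, Set.mem_image] at hC hD
    obtain ⟨c, -, rfl⟩ := hC
    obtain ⟨d, -, rfl⟩ := hD
    exact Finset.disjoint_left.2 fun x hx hx' => hCD (congrArg F (hdisj c d x hx hx'))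
  · intro C hC
    obtain ⟨c, hc, rfl⟩ := Finset.mem_image.1 hC
    refine ⟨by rw [hcardF]; simpa using hc, Finset.disjoint_left.2 fun x hx hx' => ?_, ?_⟩
    · obtain ⟨hx, -⟩ := (hF _ _).1 hx
      simp at hx hx'
      exact hx hx'
    · intro a ha b hab
      by_cases hb : b ∈ u
      · simp [hb]
      · left
        obtain ⟨ha', hac⟩ := (hF _ _).1 ha
        refine (hF _ _).2 ⟨by simpa using hb, ?_⟩
        rw [ConnectedComponent.mem_supp_iff] at hac ⊢
        rw [← hac]
        apply ConnectedComponent.connectedComponentMk_eq_of_adj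
        have ha'' : a ∉ u := by simpa using ha'
        simp [hK, hab.symm, hb, ha'']

end Mate

/-- A fractional perfect matching: a nonnegative symmetric weight supported on edges of `G` whose
sum over the edges at each vertex is one. -/
structure IsFractional {V : Type*} [Fintype V] (G : SimpleGraph V) (y : V → V → ℝ) : Prop where
  nonneg : ∀ a b, 0 ≤ y a b
  symm : ∀ a b, y a b = y b a
  adj : ∀ a b, y a b ≠ 0 → G.Adj a b
  sum_eq_one : ∀ a, ∑ b, y a b = 1

/-- The total weight of the cut `∂(X)`. -/
def cutWeight {V : Type*} [Fintype V] [DecidableEq V] (y : V → V → ℝ) (X : Finset V) : ℝ :=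
  ∑ a ∈ X, ∑ b ∈ Xᶜ, y a b

/-! ### Fractional perfect matchings under odd cut constraints -/

section Weight

variable {V : Type*} [Fintype V] [DecidableEq V] {G : SimpleGraph V} {y : V → V → ℝ}

theorem cutWeight_compl (hs : ∀ a b, y a b = y b a) (X : Finset V) :
    cutWeight y Xᶜ = cutWeight y X := by
  unfold cutWeight
  rw [compl_compl, Finset.sum_comm]
  exact sum_congr rfl fun a _ => sum_congr rfl fun b _ => hs b a

theorem IsFractional.cutWeight_singleton (hy : IsFractional G y) (a : V) :
    cutWeight y {a} = 1 := by
  have h0 : y a a = 0 := by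
    by_contra h
    exact G.irrefl (hy.adj a a h)
  have := hy.sum_eq_one a
  rw [← Finset.sum_add_sum_compl ({a} : Finset V), sum_singleton, h0, zero_add] at this
  simpa [cutWeight] using this

/-- If a fractional perfect matching satisfies all odd cut constraints, then each edge of positive
weight is in a perfect matching all of whose edges have positive weight. -/
theorem IsFractional.exists_isMate (hy : IsFractional G y)
    (hcut : ∀ X : Finset V, Odd #X → 1 ≤ cutWeight y X) {u v : V} (huv : y u v ≠ 0) :
    ∃ m, IsMate G m ∧ m u = v ∧ ∀ a, y a (m a) ≠ 0 := by
  have heven : Even (Fintype.card V) := by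
    by_contra h
    have := hcut univ (by simpa using h)
    simp only [cutWeight, compl_univ, sum_empty, sum_const_zero] at this
    linarith
  have huv' : u ≠ v := (hy.adj u v huv).ne
  -- `K` is the support of `y` with all edges at `u` other than `uv` dropped, so a perfect matching
  -- of `K` must use `uv`.
  let K : SimpleGraph V :=
    { Adj := fun a b => y a b ≠ 0 ∧ (a = u → b = v) ∧ (b = u → a = v)
      symm := ⟨fun a b h => ⟨by rw [hy.symm]; exact h.1, h.2.2, h.2.1⟩⟩
      loopless := ⟨fun a h => G.irrefl (hy.adj a a h.1)⟩ }
  have hK : ∀ a b, K.Adj a b ↔ y a b ≠ 0 ∧ (a = u → b = v) ∧ (b = u → a = v) :=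
    fun _ _ => Iff.rfl
  by_cases hm : ∃ m, IsMate K m
  · obtain ⟨m, hm⟩ := hm
    have hmy : ∀ a, y a (m a) ≠ 0 := fun a => ((hK _ _).1 (hm a).1).1
    exact ⟨m, fun a => ⟨hy.adj _ _ (hmy a), (hm a).2⟩, ((hK _ _).1 (hm u).1).2.1 rfl, hmy⟩
  exfalso
  obtain ⟨U, 𝒞, hlt, hdis, h𝒞⟩ := exists_odd_family heven hm
  -- The dropped edges all meet `u`. Without the at most one member containing `u`, and with `u`
  -- added to `U`, the family is a barrier for the whole support of `y`.
  set 𝒟 := 𝒞.filter (fun C => u ∉ C) with h𝒟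
  have hdisD : (𝒟 : Set (Finset V)).PairwiseDisjoint id :=
    hdis.subset fun C hC => (mem_filter.1 hC).1
  set U' := insert u U with hU'
  have hDU : ∀ C ∈ 𝒟, ∀ a ∈ C, a ∉ U' := by
    intro C hC a ha
    rw [h𝒟, mem_filter] at hC
    rw [hU', mem_insert, not_or]
    exact ⟨fun h => hC.2 (h ▸ ha), Finset.disjoint_left.1 (h𝒞 C hC.1).2.1 ha⟩
  have h𝒞𝒟 : #𝒞 ≤ #𝒟 + 1 := by
    have h1 : #(𝒞.filter fun C => ¬ u ∉ C) ≤ 1 := by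
      rw [card_le_one]
      intro C hC D hD
      simp only [mem_filter, not_not] at hC hD
      by_contra hCD
      exact Finset.disjoint_left.1 (hdis hC.1 hD.1 hCD) hC.2 hD.2
    have h2 : #𝒟 + #(𝒞.filter fun C => ¬ u ∉ C) = #𝒞 := by
      rw [h𝒟]
      convert card_filter_add_card_filter_not (s := 𝒞) (fun C => u ∉ C)
    omega
  set W := 𝒟.biUnion id with hW
  have hleft : (#𝒟 : ℝ) ≤ ∑ a ∈ W, ∑ b ∈ U', y a b := by
    rw [hW, sum_biUnion hdisD, ← nsmul_one (#𝒟), ← sum_const]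
    refine sum_le_sum fun C hC => ?_
    have hC' := (mem_filter.1 hC)
    refine (hcut C (h𝒞 C hC'.1).1).trans (le_of_eq ?_)
    refine sum_congr rfl fun a ha => ?_
    symm
    apply sum_subset
    · intro b hb
      rw [mem_compl]
      exact fun h => hDU C hC b h hb
    · intro b hb hbU
      by_contra hne
      rw [mem_compl] at hb
      rw [hU', mem_insert, not_or] at hbU
      rcases (h𝒞 C hC'.1).2.2 a ha b
        ((hK _ _).2 ⟨hne, fun h => absurd (h ▸ ha) hC'.2, fun h => absurd h hbU.1⟩) with h | h
      exacts [hb h, hbU.2 h]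
  rw [sum_comm] at hleft
  have hcol : ∀ (b : V) (Z : Finset V), ∑ a ∈ Z, y a b ≤ 1 := by
    intro b Z
    rw [← hy.sum_eq_one b]
    calc _ = ∑ a ∈ Z, y b a := sum_congr rfl fun a _ => hy.symm a b
      _ ≤ _ := sum_le_sum_of_subset_of_nonneg (subset_univ _) fun _ _ _ => hy.nonneg _ _
  -- The set `U'` receives at least `#𝒟 ≥ #U + 1` from `W`, while each vertex can receive at most
  -- one. If `u ∉ U`, then `v ∉ W`, and the positive weight of `uv` keeps the share of `u` strictly
  -- below one.
  by_cases hu : u ∈ U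
  · have h1 : ∑ b ∈ U', ∑ a ∈ W, y a b ≤ #U' := by
      rw [← nsmul_one (#U'), ← sum_const]
      exact sum_le_sum fun b _ => hcol b W
    have h2 : (#𝒟 : ℝ) ≤ #U' := hleft.trans h1
    rw [hU', insert_eq_of_mem hu] at h2
    have : #𝒟 ≤ #U := by exact_mod_cast h2
    omega
  · have hvW : v ∉ W := by
      intro hv
      rw [hW, mem_biUnion] at hv
      obtain ⟨C, hC, hvC⟩ := hv
      have hC' := (mem_filter.1 hC)
      rcases (h𝒞 C hC'.1).2.2 v hvC u
        ((hK _ _).2 ⟨by rwa [hy.symm], fun h => absurd h.symm huv', fun _ => rfl⟩) with h | h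
      exacts [hC'.2 h, hu h]
    have h0 : ∑ a ∈ W, y a u < 1 := by
      have h1 := hcol u (insert v W)
      rw [sum_insert hvW, hy.symm v u] at h1
      have := lt_of_le_of_ne (hy.nonneg u v) huv.symm
      linarith
    rw [hU', sum_insert hu] at hleft
    have h1 : ∑ b ∈ U, ∑ a ∈ W, y a b ≤ #U := by
      rw [← nsmul_one (#U), ← sum_const]
      exact sum_le_sum fun b _ => hcol b W
    have h2 : (#𝒟 : ℝ) < #U + 1 := by linarith
    have : #𝒟 < #U + 1 := by exact_mod_cast h2
    omega

end Weight

/-! ### Contracting odd sets whose cuts have weight one -/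

section Contraction

variable {V W : Type*} [Fintype V] [DecidableEq V] [Fintype W] [DecidableEq W]
  {G : SimpleGraph V} {y : V → V → ℝ}

/-- Let `π` be a map with odd fibres, each of which has a cut of weight one in a fractional
perfect matching `y` that satisfies the odd cut constraints and is positive on all edges of `G`.
Then each edge of the image of `G` lies in a perfect matching. -/
theorem IsFractional.exists_isMate_map (hy : IsFractional G y)
    (hcut : ∀ X : Finset V, Odd #X → 1 ≤ cutWeight y X) (hpos : ∀ a b, G.Adj a b → y a b ≠ 0)
    (π : V → W) (hodd : ∀ p, Odd #(univ.filter fun a => π a = p))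
    (hone : ∀ p, cutWeight y (univ.filter fun a => π a = p) = 1) {p q : W}
    (hpq : (G.map π).Adj p q) : ∃ m, IsMate (G.map π) m ∧ m p = q := by
  let fib : W → Finset V := fun p => univ.filter fun a => π a = p
  -- Weights of parallel edges add up and loops are dropped, so a cut in the image weighs as much as
  -- its preimage.
  let y' : W → W → ℝ := fun p q => if p = q then 0 else ∑ a ∈ fib p, ∑ b ∈ fib q, y a b
  have hsum : ∀ P Q : Finset W, Disjoint P Q → ∑ p ∈ P, ∑ q ∈ Q, y' p q =
      ∑ a ∈ univ.filter (fun a => π a ∈ P), ∑ b ∈ univ.filter (fun b => π b ∈ Q), y a b := by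
    intro P Q hPQ
    have hmaps : ∀ (R : Finset W), ∀ i ∈ univ.filter (fun a => π a ∈ R), π i ∈ R :=
      fun R i hi => (mem_filter.1 hi).2
    have hff : ∀ (R : Finset W), ∀ p ∈ R,
        (univ.filter (fun a => π a ∈ R)).filter (fun a => π a = p) = fib p := by
      intro R p hp
      ext a
      simp only [mem_filter, mem_univ, true_and, fib]
      exact ⟨fun h => h.2, fun h => ⟨h ▸ hp, h⟩⟩
    rw [← sum_fiberwise_of_maps_to (hmaps P)]
    refine sum_congr rfl fun p hp => ?_
    rw [hff P p hp]
    have : ∀ a, ∑ b ∈ univ.filter (fun b => π b ∈ Q), y a b = ∑ q ∈ Q, ∑ b ∈ fib q, y a b := by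
      intro a
      rw [← sum_fiberwise_of_maps_to (hmaps Q)]
      exact sum_congr rfl fun q hq => by rw [hff Q q hq]
    simp_rw [this]
    rw [sum_comm]
    refine sum_congr rfl fun q hq => ?_
    simp only [y']
    rw [if_neg]
    rintro rfl
    exact Finset.disjoint_left.1 hPQ hp hq
  have hcw : ∀ P : Finset W, cutWeight y' P = cutWeight y (univ.filter fun a => π a ∈ P) := by
    intro P
    unfold cutWeight
    rw [hsum P Pᶜ disjoint_compl_right]
    refine sum_congr rfl fun a _ => sum_congr ?_ fun _ _ => rfl
    ext b
    simp
  have hy' : IsFractional (G.map π) y' := by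
    refine ⟨fun p q => ?_, fun p q => ?_, fun p q h => ?_, fun p => ?_⟩
    · simp only [y']
      split_ifs
      exacts [le_rfl, sum_nonneg fun _ _ => sum_nonneg fun _ _ => hy.nonneg _ _]
    · simp only [y', eq_comm (a := p)]
      split_ifs
      · rfl
      · rw [sum_comm]
        exact sum_congr rfl fun _ _ => sum_congr rfl fun _ _ => hy.symm _ _
    · simp only [y'] at h
      split_ifs at h with hpq
      · exact absurd rfl h
      · obtain ⟨a, ha, h⟩ := exists_ne_zero_of_sum_ne_zero h
        obtain ⟨b, hb, h⟩ := exists_ne_zero_of_sum_ne_zero h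
        exact ⟨hpq, a, b, hy.adj a b h, (mem_filter.1 ha).2, (mem_filter.1 hb).2⟩
    · have h1 : cutWeight y' {p} = 1 := by
        rw [hcw]
        simpa using hone p
      have h2 : y' p p = 0 := by simp [y']
      rw [← Finset.sum_add_sum_compl ({p} : Finset W), sum_singleton, h2, zero_add]
      simpa [cutWeight] using h1
  -- Odd fibres make the preimage of an odd set odd, so the constraint is inherited from `y`.
  have hcut' : ∀ P : Finset W, Odd #P → 1 ≤ cutWeight y' P := by
    intro P hP
    rw [hcw]
    apply hcut
    rw [card_eq_sum_card_fiberwise (f := π) (t := P) fun a ha => by simpa using ha,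
      Finset.odd_sum_iff_odd_card_odd]
    convert hP using 2
    refine filter_true_of_mem fun p hp => ?_
    convert hodd p using 2
    ext a
    simp only [mem_filter, mem_univ, true_and]
    exact ⟨fun h => h.2, fun h => ⟨h ▸ hp, h⟩⟩
  have hpos' : y' p q ≠ 0 := by
    obtain ⟨hne, a, b, hab, ha, hb⟩ := hpq
    simp only [y', if_neg hne]
    have hab' := lt_of_le_of_ne (hy.nonneg a b) (hpos a b hab).symm
    have h1 : y a b ≤ ∑ b ∈ fib q, y a b :=
      single_le_sum (f := fun b => y a b) (fun b _ => hy.nonneg a b) (by simpa [fib] using hb)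
    have h2 : ∑ b ∈ fib q, y a b ≤ ∑ a ∈ fib p, ∑ b ∈ fib q, y a b :=
      single_le_sum (f := fun a => ∑ b ∈ fib q, y a b)
        (fun a _ => sum_nonneg fun b _ => hy.nonneg a b) (by simpa [fib] using ha)
    linarith
  obtain ⟨m, hm, hmp, -⟩ := hy'.exists_isMate hcut' hpos'
  exact ⟨m, hm, hmp⟩

end Contraction

/-! ### The average of all perfect matchings -/

section Average

variable {V : Type*} [Fintype V] [DecidableEq V] {G : SimpleGraph V}

/-- The average of all perfect matchings of a matching covered graph. -/
theorem IsMatchingCovered.exists_isFractional (h : IsMatchingCovered G) :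
    ∃ z, IsFractional G z ∧ (∀ a b, G.Adj a b → z a b ≠ 0) ∧
      ∀ X : Finset V, Odd #X → 1 ≤ cutWeight z X := by
  classical
  let ms : Finset (V → V) := univ.filter (IsMate G)
  have hms : ∀ m, m ∈ ms ↔ IsMate G m := by simp [ms]
  have hne : ms.Nonempty := by
    have := h.2.1
    obtain ⟨a⟩ := h.1.nonempty
    obtain ⟨b, hab⟩ := h.1.preconnected.exists_adj_of_nontrivial a
    obtain ⟨m, hm, -⟩ := h.exists_isMate hab
    exact ⟨m, (hms m).2 hm⟩
  have hcard : (0 : ℝ) < #ms := by exact_mod_cast hne.card_pos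
  let z : V → V → ℝ := fun a b => (∑ m ∈ ms, if m a = b then 1 else 0) / #ms
  have hterm : ∀ a b (m : V → V), (0 : ℝ) ≤ if m a = b then 1 else 0 := by
    intro a b m
    split_ifs <;> norm_num
  have hz0 : ∀ a b, 0 ≤ z a b := fun a b =>
    div_nonneg (sum_nonneg fun m _ => hterm a b m) hcard.le
  refine ⟨z, ⟨hz0, fun a b => ?_, fun a b hab => ?_, fun a => ?_⟩, fun a b hab => ?_,
    fun X hX => ?_⟩
  · simp only [z]
    congr 1
    refine sum_congr rfl fun m hm => ?_
    have hm := (hms m).1 hm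
    have : m a = b ↔ m b = a :=
      ⟨fun h => by rw [← h, (hm a).2], fun h => by rw [← h, (hm b).2]⟩
    simp only [this]
  · simp only [z] at hab
    obtain ⟨m, hm, hm'⟩ := exists_ne_zero_of_sum_ne_zero (fun h => hab (by rw [h, zero_div]))
    have : m a = b := by
      by_contra h
      simp [h] at hm'
    exact this ▸ ((hms m).1 hm a).1
  · simp only [z]
    rw [← sum_div, sum_comm]
    simp [hcard.ne']
  · obtain ⟨m, hm, hmab⟩ := h.exists_isMate hab
    simp only [z]
    refine (div_pos (sum_pos' (fun m _ => hterm a b m) ⟨m, (hms m).2 hm, ?_⟩) hcard).ne'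
    simp [hmab]
  · unfold cutWeight
    simp only [z]
    simp_rw [← sum_div]
    rw [le_div_iff₀ hcard, one_mul]
    have h1 : ∑ a ∈ X, ∑ b ∈ Xᶜ, ∑ m ∈ ms, (if m a = b then (1 : ℝ) else 0) =
        ∑ m ∈ ms, ∑ a ∈ X, ∑ b ∈ Xᶜ, (if m a = b then (1 : ℝ) else 0) := by
      rw [sum_comm (s := ms)]
      exact sum_congr rfl fun a _ => sum_comm
    rw [h1, ← nsmul_one (#ms), ← sum_const]
    refine sum_le_sum fun m hm => ?_
    obtain ⟨a, ha, hma⟩ := ((hms m).1 hm).exists_of_odd hX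
    calc (1 : ℝ) = ∑ b ∈ Xᶜ, (if m a = b then (1 : ℝ) else 0) := by simp [hma]
      _ ≤ _ := single_le_sum (f := fun a => ∑ b ∈ Xᶜ, (if m a = b then (1 : ℝ) else 0))
          (fun a _ => sum_nonneg fun b _ => hterm a b m) ha

end Average

/-! ### Separating cuts from cuts of weight one -/

theorem connected_map_of_surjective {V W : Type*} {G : SimpleGraph V} (hG : G.Connected)
    {π : V → W} (hπ : Function.Surjective π) : (G.map π).Connected := by
  have hwalk : ∀ {a b : V}, G.Walk a b → (G.map π).Reachable (π a) (π b) := by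
    intro a b p
    induction p with
    | nil => rfl
    | @cons a b c h _ ih =>
      by_cases hab : π a = π b
      · rwa [hab]
      · exact (Adj.reachable (map_adj_apply' h hab)).trans ih
  have : Nonempty W := hG.nonempty.map π
  refine ⟨fun p q => ?_⟩
  obtain ⟨a, rfl⟩ := hπ p
  obtain ⟨b, rfl⟩ := hπ q
  exact (hG.preconnected a b).elim hwalk

section Separating

variable {V : Type*} [Fintype V] [DecidableEq V] {G : SimpleGraph V} {y : V → V → ℝ}

/-- The fibres of the shrinking map are `X` and singletons, all odd and with cuts of weight one. -/
theorem IsFractional.isMatchingCovered_contract (hG : G.Connected) (hy : IsFractional G y)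
    (hcut : ∀ X : Finset V, Odd #X → 1 ≤ cutWeight y X) (hpos : ∀ a b, G.Adj a b → y a b ≠ 0)
    {X : Finset V} (hX : Odd #X) (hX' : Xᶜ.Nonempty) (h1 : cutWeight y X = 1) :
    IsMatchingCovered (contract G (X : Set V)) := by
  classical
  obtain ⟨w, hw⟩ := hX'
  obtain ⟨x, hx⟩ : X.Nonempty := card_pos.1 hX.pos
  have hw' : w ∉ (X : Set V) := by simpa using hw
  have : Nontrivial (Option {v : V // v ∉ (X : Set V)}) := ⟨none, some ⟨w, hw'⟩, by simp⟩
  have hfnone : (univ.filter fun a => shrink (X : Set V) a = none) = X := by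
    ext a
    simp [shrink]
  have hfsome : ∀ p : {v : V // v ∉ (X : Set V)},
      (univ.filter fun a => shrink (X : Set V) a = some p) = {p.1} := by
    rintro ⟨p, hp⟩
    ext a
    by_cases ha : a ∈ (X : Set V)
    · have : a ≠ p := fun h => hp (h ▸ ha)
      have ha' : a ∈ X := ha
      simp [shrink, ha', this]
    · have ha' : a ∉ X := ha
      simp [shrink, ha']
  have hsurj : Function.Surjective (shrink (X : Set V)) := by
    rintro (_ | ⟨p, hp⟩)
    · exact ⟨x, by simp [shrink, hx]⟩
    · exact ⟨p, by simp [shrink, hp]⟩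
  refine isMatchingCovered_of_isMate (connected_map_of_surjective hG hsurj) fun p q hpq => ?_
  refine hy.exists_isMate_map hcut hpos (shrink (X : Set V)) ?_ ?_ hpq
  · rintro (_ | p)
    · rwa [hfnone]
    · rw [hfsome]
      simp
  · rintro (_ | p)
    · rwa [hfnone]
    · rw [hfsome]
      exact hy.cutWeight_singleton _

theorem IsFractional.isSeparatingCut (hG : G.Connected) (hy : IsFractional G y)
    (hcut : ∀ X : Finset V, Odd #X → 1 ≤ cutWeight y X) (hpos : ∀ a b, G.Adj a b → y a b ≠ 0)
    (heven : Even (Fintype.card V)) {X : Finset V} (hX : Odd #X) (h1 : cutWeight y X = 1) :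
    IsSeparatingCut G (X : Set V) := by
  have hcard := card_add_card_compl X
  have hX' : Odd #Xᶜ := by
    by_contra h
    rw [Nat.not_odd_iff_even] at h
    grind
  refine ⟨hy.isMatchingCovered_contract hG hcut hpos hX (card_pos.1 hX'.pos) h1, ?_⟩
  rw [← coe_compl]
  refine hy.isMatchingCovered_contract hG hcut hpos hX' ?_ ?_
  · rw [compl_compl]
    exact card_pos.1 hX.pos
  · rwa [cutWeight_compl hy.symm]

/-- In a solid brick, each edge in the support of a fractional perfect matching is in a perfect
matching contained in that support. -/
theorem IsFractional.exists_isMate_of_isSolid (hbrick : IsBrick G) (hsolid : IsSolid G)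
    (hy : IsFractional G y) {u v : V} (huv : y u v ≠ 0) :
    ∃ m, IsMate G m ∧ m u = v ∧ ∀ a, y a (m a) ≠ 0 := by
  classical
  refine hy.exists_isMate (fun X₀ hX₀ => ?_) huv
  by_contra! hlt₀
  obtain ⟨z, hz, hzpos, hzcut⟩ := hbrick.1.exists_isFractional
  obtain ⟨m, hm, -⟩ := hbrick.1.exists_isMate (hy.adj u v huv)
  let 𝒮 : Finset (Finset V) := univ.filter fun X => Odd #X ∧ cutWeight y X < 1
  -- `T X` is the parameter at which `X` has weight exactly one on the segment from `z` to `y`; the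
  -- minimum over violated cuts marks the first one to become binding.
  let T : Finset V → ℝ := fun X => (cutWeight z X - 1) / (cutWeight z X - cutWeight y X)
  obtain ⟨X, hX, hmin⟩ := exists_min_image 𝒮 T ⟨X₀, by simp [𝒮, hX₀, hlt₀]⟩
  obtain ⟨hXodd, hXlt⟩ : Odd #X ∧ cutWeight y X < 1 := by simpa [𝒮] using hX
  have hzX := hzcut X hXodd
  have hden : 0 < cutWeight z X - cutWeight y X := by linarith
  set t := T X with ht
  have ht0 : 0 ≤ t := div_nonneg (by linarith) hden.le
  have ht1 : t < 1 := by
    rw [ht]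
    exact (div_lt_one hden).2 (by linarith)
  let w : V → V → ℝ := fun a b => (1 - t) * z a b + t * y a b
  have hwcut : ∀ Y, cutWeight w Y = (1 - t) * cutWeight z Y + t * cutWeight y Y := by
    intro Y
    simp only [cutWeight, w, sum_add_distrib, mul_sum]
  have hwpos : ∀ a b, G.Adj a b → w a b ≠ 0 := by
    intro a b hab
    have h1 := lt_of_le_of_ne (hz.nonneg a b) (hzpos a b hab).symm
    have h2 := mul_pos (sub_pos.2 ht1) h1
    have h3 := mul_nonneg ht0 (hy.nonneg a b)
    exact (add_pos_of_pos_of_nonneg h2 h3).ne'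
  have hw : IsFractional G w := by
    refine ⟨fun a b => ?_, fun a b => ?_, fun a b hab => ?_, fun a => ?_⟩
    · exact add_nonneg (mul_nonneg (sub_pos.2 ht1).le (hz.nonneg a b))
        (mul_nonneg ht0 (hy.nonneg a b))
    · simp only [w]
      rw [hz.symm a b, hy.symm a b]
    · by_contra hnab
      have h1 : z a b = 0 := by_contra fun h => hnab (hz.adj a b h)
      have h2 : y a b = 0 := by_contra fun h => hnab (hy.adj a b h)
      simp [w, h1, h2] at hab
    · simp only [w]
      rw [sum_add_distrib, ← mul_sum, ← mul_sum, hz.sum_eq_one, hy.sum_eq_one]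
      ring
  have hw1 : ∀ Y : Finset V, Odd #Y → 1 ≤ cutWeight w Y := by
    intro Y hY
    rw [hwcut]
    have hzY := hzcut Y hY
    by_cases hyY : 1 ≤ cutWeight y Y
    · nlinarith
    · push Not at hyY
      have htY := hmin Y (by simp [𝒮, hY, hyY])
      have hdY : 0 < cutWeight z Y - cutWeight y Y := by linarith
      have := (le_div_iff₀ hdY).1 htY
      linarith
  have hwX : cutWeight w X = 1 := by
    rw [hwcut]
    have : t * (cutWeight z X - cutWeight y X) = cutWeight z X - 1 :=
      div_mul_cancel₀ _ hden.ne'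
    linarith
  have hsep := hw.isSeparatingCut hbrick.1.1 hw1 hwpos (even_card hm) hXodd hwX
  rcases hbrick.2.2 _ (hsolid.2 _ hsep) with h | h
  · rw [Set.ncard_coe_finset, card_eq_one] at h
    obtain ⟨a, rfl⟩ := h
    exact hXlt.ne (hy.cutWeight_singleton a)
  · rw [← coe_compl, Set.ncard_coe_finset, card_eq_one] at h
    obtain ⟨a, ha⟩ := h
    rw [← cutWeight_compl hy.symm, ha] at hXlt
    exact hXlt.ne (hy.cutWeight_singleton a)

end Separating

/-! ### Connectivity and parity -/

section Closed

variable {V : Type*} {G : SimpleGraph V}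

theorem mem_of_closed (hG : G.Connected) {X : Finset V} (hX : X.Nonempty)
    (h : ∀ a ∈ X, ∀ b, G.Adj a b → b ∈ X) (c : V) : c ∈ X := by
  obtain ⟨a, ha⟩ := hX
  obtain ⟨p⟩ := hG.preconnected a c
  induction p with
  | nil => exact ha
  | cons hab _ ih => exact ih (h _ ha _ hab)

theorem IsMatchingCovered.exists_isMate_self (h : IsMatchingCovered G) : ∃ m, IsMate G m := by
  have := h.2.1
  obtain ⟨a⟩ := h.1.nonempty
  obtain ⟨b, hab⟩ := h.1.preconnected.exists_adj_of_nontrivial a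
  obtain ⟨m, hm, -⟩ := h.exists_isMate hab
  exact ⟨m, hm⟩

/-- A set of vertices separated from the rest of a matching covered graph by one vertex is odd. -/
theorem IsMatchingCovered.odd_card_of_cutVertex [DecidableEq V] (h : IsMatchingCovered G)
    {R : Finset V} {z : V}
    (hne : R.Nonempty) (hz : z ∉ R) (hR : ∀ r ∈ R, ∀ b, G.Adj r b → b ∈ R ∨ b = z) : Odd #R := by
  by_contra hodd
  rw [Nat.not_odd_iff_even] at hodd
  refine hz (mem_of_closed h.1 hne (fun r hr b hrb => (hR r hr b hrb).resolve_right ?_) z)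
  rintro rfl
  -- A perfect matching through the edge from `r` to the separating vertex pairs off the rest of
  -- `R`, which is odd if `R` is even.
  obtain ⟨m, hm, rfl⟩ := h.exists_isMate hrb
  have h1 : Even #(R.erase r) := even_card_of_isMate hm fun a ha => by
    obtain ⟨har, haR⟩ := mem_erase.1 ha
    refine mem_erase.2 ⟨?_, (hR a haR _ (hm a).1).resolve_right fun h => har (hm.injective h)⟩
    rintro h
    rw [← h, (hm a).2] at hz
    exact hz haR
  have h2 := card_erase_add_one hr
  grind

end Closed

/-! ### Expansion of stable sets; obstructions to removability -/

section Structure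

variable {V : Type*} [Fintype V] [DecidableEq V] {G : SimpleGraph V}

open Classical in
/-- The vertices outside `I` that are adjacent to a vertex of `I`. -/
noncomputable def outer (G : SimpleGraph V) (I : Finset V) : Finset V :=
  univ.filter fun b => b ∉ I ∧ ∃ a ∈ I, G.Adj a b

theorem mem_outer {I : Finset V} {b : V} : b ∈ outer G I ↔ b ∉ I ∧ ∃ a ∈ I, G.Adj a b := by
  simp [outer]

/-- The partners of a stable set `S` are exactly the outer vertices matched into `S`. The excess
`#(outer G S) - #S` thus counts, in every perfect matching, the outer vertices matched elsewhere. -/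
theorem IsMate.card_outer {m : V → V} (hm : IsMate G m) {S : Finset V}
    (hS : ∀ a ∈ S, ∀ b ∈ S, ¬ G.Adj a b) :
    #((outer G S).filter fun a => m a ∉ S) + #S = #(outer G S) := by
  have h1 : (outer G S).filter (fun a => ¬ m a ∉ S) = S.image m := by
    ext a
    simp only [mem_filter, not_not, mem_image]
    constructor
    · exact fun h => ⟨m a, h.2, (hm a).2⟩
    · rintro ⟨b, hb, rfl⟩
      refine ⟨mem_outer.2 ⟨fun h => hS b hb _ h (hm b).1, b, hb, (hm b).1⟩, ?_⟩
      rwa [(hm b).2]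
  have h2 : #(S.image m) = #S := card_image_of_injective _ hm.injective
  rw [← h2, ← h1]
  convert card_filter_add_card_filter_not (s := outer G S) (fun a => m a ∉ S)

/-- With excess zero, outer vertices are adjacent only to `S`, so `G` is bipartite. With excess one,
no edge joins two outer vertices and the cut of `S ∪ outer G S` is tight, hence trivial; one vertex
remains outside, and `G` is again bipartite. -/
theorem IsBrick.card_add_two_le_card_outer (hbrick : IsBrick G) {S : Finset V} (hne : S.Nonempty)
    (hS : ∀ a ∈ S, ∀ b ∈ S, ¬ G.Adj a b) : #S + 2 ≤ #(outer G S) := by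
  classical
  have hbip : ∀ S' : Finset V, (∀ a b, G.Adj a b → (a ∈ S' ↔ b ∉ S')) → False := by
    intro S' h
    apply hbrick.2.1
    have c : G.Coloring Bool := Coloring.mk (fun a => decide (a ∈ S')) (by
      intro a b hab
      have := h a b hab
      by_cases h1 : a ∈ S' <;> simp_all)
    simpa using c.colorable
  obtain ⟨m₀, hm₀⟩ := hbrick.1.exists_isMate_self
  have hm₀c := hm₀.card_outer hS
  by_contra! hlt
  set X := S ∪ outer G S with hX
  have hXne : X.Nonempty := hne.mono subset_union_left
  have hSN : Disjoint S (outer G S) := Finset.disjoint_right.2 fun a ha => (mem_outer.1 ha).1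
  have hSX : ∀ a ∈ S, ∀ b, G.Adj a b → b ∈ outer G S := fun a ha b hab =>
    mem_outer.2 ⟨fun h => hS a ha b h hab, a, ha, hab⟩
  have hcard : ∀ m, IsMate G m →
      #((outer G S).filter fun a => m a ∉ S) = #(outer G S) - #S := fun m hm => by
    have := hm.card_outer hS
    omega
  rcases Nat.lt_or_ge (#S) (#(outer G S)) with hlt' | hge
  · have hc1 : ∀ m, IsMate G m → ∃ c, (outer G S).filter (fun a => m a ∉ S) = {c} := by
      intro m hm
      rw [← card_eq_one, hcard m hm]
      omega
    have hNN : ∀ a ∈ outer G S, ∀ b ∈ outer G S, ¬ G.Adj a b := by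
      intro a ha b hb hab
      obtain ⟨m, hm, hmab⟩ := hbrick.1.exists_isMate hab
      obtain ⟨c, hc⟩ := hc1 m hm
      have h1 : a ∈ (outer G S).filter (fun a => m a ∉ S) :=
        mem_filter.2 ⟨ha, by rw [hmab]; exact (mem_outer.1 hb).1⟩
      have h2 : b ∈ (outer G S).filter (fun a => m a ∉ S) :=
        mem_filter.2 ⟨hb, by rw [← hmab, (hm a).2]; exact (mem_outer.1 ha).1⟩
      rw [hc, mem_singleton] at h1 h2
      exact hab.ne (h1.trans h2.symm)
    have htight : IsTightCut G (X : Set V) := by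
      refine isTightCut_of_isMate fun m hm => ?_
      obtain ⟨c, hc⟩ := hc1 m hm
      have hcm : c ∈ (outer G S).filter (fun a => m a ∉ S) := by simp [hc]
      obtain ⟨hcN, hcS⟩ := mem_filter.1 hcm
      refine ⟨c, by simp [hX, hcN], ?_, ?_⟩
      · simp only [hX, coe_union, Set.mem_union, mem_coe, not_or]
        exact ⟨hcS, fun h => hNN c hcN _ h (hm c).1⟩
      · intro b hb hmb
        simp only [hX, coe_union, Set.mem_union, mem_coe, not_or] at hb hmb
        rcases hb with hb | hb
        · exact absurd (hSX b hb _ (hm b).1) hmb.2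
        · have : b ∈ (outer G S).filter (fun a => m a ∉ S) := mem_filter.2 ⟨hb, hmb.1⟩
          simpa [hc] using this
    have hXc : #X = #S + #(outer G S) := card_union_of_disjoint hSN
    have hS0 := hne.card_pos
    rcases hbrick.2.2 _ htight with h | h
    · rw [Set.ncard_coe_finset] at h
      omega
    · rw [← coe_compl, Set.ncard_coe_finset, card_eq_one] at h
      obtain ⟨w, hw⟩ := h
      have hw' : ∀ b, b ∉ S → b ∉ outer G S → b = w := by
        intro b h1 h2
        have : b ∈ Xᶜ := by simp [hX, h1, h2]
        simpa [hw] using this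
      have hwX : w ∉ X := by
        rw [← mem_compl, hw]
        simp
      have hwX' : w ∉ S ∧ w ∉ outer G S := by simpa [hX] using hwX
      refine hbip (outer G S) fun a b hab => ⟨fun ha hb => hNN a ha b hb hab, fun hb => ?_⟩
      by_contra ha
      have h1 : a ∉ S := fun h => hb (hSX a h b hab)
      have h2 : b ∉ S := fun h => ha (hSX b h a hab.symm)
      exact hab.ne ((hw' a h1 ha).trans (hw' b h2 hb).symm)
  · have hNS : ∀ a ∈ outer G S, ∀ b, G.Adj a b → b ∈ S := by
      intro a ha b hab
      obtain ⟨m, hm, rfl⟩ := hbrick.1.exists_isMate hab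
      have := hcard m hm
      rw [Nat.sub_eq_zero_of_le hge, card_eq_zero, filter_eq_empty_iff] at this
      simpa using this ha
    have hall := mem_of_closed hbrick.1.1 hXne (fun a ha b hab => by
      rcases mem_union.1 ha with h | h
      · exact mem_union_right _ (hSX a h b hab)
      · exact mem_union_left _ (hNS a h b hab))
    refine hbip S fun a b hab => ⟨fun ha hb => hS a ha b hb hab, fun hb => ?_⟩
    by_contra ha
    exact ha (hNS b ((mem_union.1 (hall b)).resolve_left hb) a hab.symm)

/-- Let `T` be the side of `x` if `xy` is a bridge. If `T` is even, a perfect matching through `xy`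
pairs off the odd set `T.erase x`. If `T` is odd, every perfect matching uses `xy`, so `x` has only
the neighbour `y`, though degrees in a brick are at least three. -/
theorem IsBrick.connected_deleteEdges (hbrick : IsBrick G) {x y : V} (hxy : G.Adj x y) :
    (G.deleteEdges {s(x, y)}).Connected := by
  classical
  have hN := hbrick.card_add_two_le_card_outer (singleton_nonempty x) (by simp)
  apply hbrick.1.1.connected_delete_edge_of_not_isBridge
  rw [isBridge_iff]
  intro hreach
  set T : Finset V := univ.filter fun v => (G.deleteEdges {s(x, y)}).Reachable x v with hT
  have hmem : ∀ v, v ∈ T ↔ (G.deleteEdges {s(x, y)}).Reachable x v := by simp [hT]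
  have hxT : x ∈ T := (hmem x).2 (Reachable.refl _)
  have hyT : y ∉ T := fun h => hreach (by simpa using (hmem y).1 h)
  have hleave : ∀ a ∈ T, ∀ b ∉ T, G.Adj a b → a = x ∧ b = y := by
    intro a ha b hb hab
    by_cases he : s(a, b) = s(x, y)
    · rcases Sym2.eq_iff.1 he with h | h
      · exact h
      · exact absurd (h.1 ▸ ha) hyT
    · refine absurd ((hmem b).2 (((hmem a).1 ha).trans (Adj.reachable ?_))) hb
      simpa [deleteEdges_adj, hab] using he
  rcases Nat.even_or_odd (#T) with heven | hodd
  · obtain ⟨m, hm, hmx⟩ := hbrick.1.exists_isMate hxy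
    have h1 : Even #(T.erase x) := even_card_of_isMate hm fun a ha => by
      obtain ⟨hax, haT⟩ := mem_erase.1 ha
      refine mem_erase.2 ⟨?_, by_contra fun h => hax (hleave a haT _ h (hm a).1).1⟩
      intro h
      rw [← h, (hm a).2] at hmx
      exact hyT (hmx ▸ haT)
    have h2 := card_erase_add_one hxT
    grind
  · have hsub : outer G {x} ⊆ {y} := by
      intro b hb
      obtain ⟨-, a, ha, hab⟩ := mem_outer.1 hb
      rw [mem_singleton] at ha ⊢
      subst ha
      obtain ⟨m, hm, rfl⟩ := hbrick.1.exists_isMate hab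
      obtain ⟨c, hc, hmc⟩ := hm.exists_of_odd hodd
      obtain ⟨rfl, h⟩ := hleave c hc _ hmc (hm c).1
      exact h
    have := card_le_card hsub
    simp at this hN
    omega

/-- In a solid brick, the obstruction to the removability of an edge `xy` is a set `I` of vertices
that contains `x` and `y`, spans no other edge, and has at most `#I` neighbours. -/
theorem exists_obstruction (hbrick : IsBrick G) (hsolid : IsSolid G) {x y : V} (hxy : G.Adj x y)
    (hrem : ¬ IsRemovable G s(x, y)) :
    ∃ I : Finset V, x ∈ I ∧ y ∈ I ∧ (∀ a ∈ I, ∀ b ∈ I, G.Adj a b → s(a, b) = s(x, y)) ∧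
      #(outer G I) ≤ #I := by
  classical
  by_contra! hI
  apply hrem
  set G' := G.deleteEdges {s(x, y)} with hG'
  have hadj : ∀ a b, G'.Adj a b ↔ G.Adj a b ∧ s(a, b) ≠ s(x, y) := by
    intro a b
    simp [hG', deleteEdges_adj]
  have hconn : G'.Connected := hbrick.connected_deleteEdges hxy
  have := hbrick.1.2.1
  refine ⟨hxy, isMatchingCovered_of_isMate hconn fun u v huv => ?_⟩
  let N : Finset V → Finset V := fun T => univ.filter fun b => ∃ a ∈ T, G'.Adj a b
  have hN : ∀ T b, b ∈ N T ↔ ∃ a ∈ T, G'.Adj a b := by simp [N]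
  have hstable : ∀ T : Finset V, T.Nonempty → (∀ a ∈ T, ∀ b ∈ T, ¬ G'.Adj a b) →
      #T + 1 ≤ #(N T) := by
    intro T hT hst
    have hed : ∀ a ∈ T, ∀ b ∈ T, G.Adj a b → s(a, b) = s(x, y) := fun a ha b hb hab => by
      by_contra h
      exact hst a ha b hb ((hadj a b).2 ⟨hab, h⟩)
    by_cases hxyT : x ∈ T ∧ y ∈ T
    · have h1 := hI T hxyT.1 hxyT.2 hed
      have h2 : outer G T ⊆ N T := by
        intro b hb
        obtain ⟨hbT, a, ha, hab⟩ := mem_outer.1 hb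
        refine (hN T b).2 ⟨a, ha, (hadj a b).2 ⟨hab, fun h => hbT ?_⟩⟩
        rcases Sym2.eq_iff.1 h with h | h
        exacts [h.2 ▸ hxyT.2, h.2 ▸ hxyT.1]
      have := card_le_card h2
      omega
    · have hst' : ∀ a ∈ T, ∀ b ∈ T, ¬ G.Adj a b := by
        intro a ha b hb hab
        rcases Sym2.eq_iff.1 (hed a ha b hb hab) with h | h
        · exact hxyT ⟨h.1 ▸ ha, h.2 ▸ hb⟩
        · exact hxyT ⟨h.2 ▸ hb, h.1 ▸ ha⟩
      have h1 := hbrick.card_add_two_le_card_outer hT hst'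
      -- Deleting `xy` costs `T` at most one neighbour, which the surplus of two absorbs.
      obtain ⟨w, hw⟩ : ∃ w, outer G T ⊆ insert w (N T) := by
        by_cases hxT : x ∈ T
        · refine ⟨y, fun b hb => ?_⟩
          obtain ⟨hbT, a, ha, hab⟩ := mem_outer.1 hb
          rw [mem_insert, hN, or_iff_not_imp_left]
          refine fun hby => ⟨a, ha, (hadj a b).2 ⟨hab, fun h => ?_⟩⟩
          rcases Sym2.eq_iff.1 h with h | h
          exacts [hby h.2, hbT (h.2 ▸ hxT)]
        · refine ⟨x, fun b hb => ?_⟩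
          obtain ⟨hbT, a, ha, hab⟩ := mem_outer.1 hb
          rw [mem_insert, hN, or_iff_not_imp_left]
          refine fun hbx => ⟨a, ha, (hadj a b).2 ⟨hab, fun h => ?_⟩⟩
          rcases Sym2.eq_iff.1 h with h | h
          exacts [hxT (h.1 ▸ ha), hbx h.2]
      have := (card_le_card hw).trans (card_insert_le _ _)
      omega
  have hexp : ∀ T : Finset V, T.Nonempty → (∃ w, w ∉ T) → #T + 1 ≤ #(N T) := by
    rintro T hT ⟨w, hw⟩
    by_contra! hlt
    -- `T \ N T` is stable with neighbours in `N T \ T`; the common part `T ∩ N T` counts equally on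
    -- both sides, so expansion of stable sets passes to `T`.
    have h1 : N (T \ N T) ⊆ N T \ T := by
      intro b hb
      obtain ⟨a, ha, hab⟩ := (hN _ b).1 hb
      obtain ⟨haT, haN⟩ := mem_sdiff.1 ha
      exact mem_sdiff.2 ⟨(hN T b).2 ⟨a, haT, hab⟩,
        fun hbT => haN ((hN T a).2 ⟨b, hbT, hab.symm⟩)⟩
    by_cases hT0 : (T \ N T).Nonempty
    · have h2 := hstable _ hT0 fun a ha b hb hab =>
        (mem_sdiff.1 ha).2 ((hN T a).2 ⟨b, (mem_sdiff.1 hb).1, hab.symm⟩)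
      have h3 := card_le_card h1
      have h4 := card_sdiff_add_card_inter T (N T)
      have h5 := card_sdiff_add_card_inter (N T) T
      rw [inter_comm] at h5
      omega
    · rw [not_nonempty_iff_eq_empty, sdiff_eq_empty_iff_subset] at hT0
      have hTN : T = N T := eq_of_subset_of_card_le hT0 (by omega)
      exact hw (mem_of_closed hconn hT (fun a ha b hab => by
        rw [hTN]
        exact (hN T b).2 ⟨a, ha, hab⟩) w)
  -- A system of representatives is a permutation along edges of `G'` taking `u` to `v`. The spare
  -- neighbour from `hexp` pays for withholding `v` from the other vertices.
  let t : V → Finset V := fun a => if a = u then {v} else (N {a}).erase v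
  have htu : t u = {v} := by simp [t]
  have ht : ∀ T : Finset V, u ∉ T → (N T).erase v ⊆ T.biUnion t := by
    intro T hT b hb
    obtain ⟨hbv, hb⟩ := mem_erase.1 hb
    obtain ⟨a, ha, hab⟩ := (hN T b).1 hb
    have hau : a ≠ u := fun h => hT (h ▸ ha)
    refine mem_biUnion.2 ⟨a, ha, ?_⟩
    simp only [t, if_neg hau]
    exact mem_erase.2 ⟨hbv, (hN _ _).2 ⟨a, mem_singleton_self a, hab⟩⟩
  have hcardT : ∀ T : Finset V, u ∉ T → #T ≤ #((N T).erase v) := by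
    intro T hT
    rcases T.eq_empty_or_nonempty with rfl | hne
    · simp
    · have h1 := hexp T hne ⟨u, hT⟩
      have h2 := pred_card_le_card_erase (s := N T) (a := v)
      omega
  have hHall : ∀ T : Finset V, #T ≤ #(T.biUnion t) := by
    intro T
    by_cases hu : u ∈ T
    · rw [← insert_erase hu, biUnion_insert, htu, card_insert_of_notMem (notMem_erase u T)]
      have h1 := hcardT _ (notMem_erase u T)
      have h2 := ht _ (notMem_erase u T)
      have h3 : insert v ((N (T.erase u)).erase v) ⊆ {v} ∪ (T.erase u).biUnion t := by
        rw [insert_eq]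
        exact union_subset_union_right h2
      have h4 := card_le_card h3
      rw [card_insert_of_notMem (notMem_erase v _)] at h4
      omega
    · exact (hcardT T hu).trans (card_le_card (ht T hu))
  obtain ⟨f, hf, hft⟩ := (all_card_le_biUnion_card_iff_exists_injective t).1 hHall
  have hfu : f u = v := by simpa [htu] using hft u
  have hfadj : ∀ a, G'.Adj a (f a) := by
    intro a
    by_cases ha : a = u
    · rw [ha, hfu]
      exact huv
    · have := hft a
      simp only [t, if_neg ha] at this
      obtain ⟨c, hc, h⟩ := (hN _ _).1 (mem_erase.1 this).2
      rwa [mem_singleton.1 hc] at h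
  let g : V ≃ V := Equiv.ofBijective f hf.bijective_of_finite
  have hg : ∀ a b, f b = a ↔ b = g.symm a := fun a b =>
    ⟨fun h => by rw [Equiv.eq_symm_apply]; exact h, fun h => by rw [h]; exact g.apply_symm_apply a⟩
  -- The average of a permutation and its inverse is symmetric: a half-integral fractional perfect
  -- matching inside `G'`.
  let w : V → V → ℝ := fun a b =>
    ((if f a = b then 1 else 0) + (if f b = a then 1 else 0)) / 2
  have hw' : ∀ a b, w a b ≠ 0 → G'.Adj a b := by
    intro a b h
    by_cases h1 : f a = b
    · exact h1 ▸ hfadj a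
    · by_cases h2 : f b = a
      · exact h2 ▸ (hfadj b).symm
      · simp [w, h1, h2] at h
  have hw : IsFractional G w := by
    refine ⟨fun a b => ?_, fun a b => ?_, fun a b h => ((hadj a b).1 (hw' a b h)).1, fun a => ?_⟩
    · simp only [w]
      split_ifs <;> norm_num
    · simp only [w]
      rw [add_comm]
    · simp only [w]
      have h1 : ∑ b, (if f b = a then (1 : ℝ) else 0) = 1 := by simp [hg]
      have h2 : ∑ b, (if f a = b then (1 : ℝ) else 0) = 1 := by simp
      rw [← sum_div, sum_add_distrib, h1, h2]
      norm_num
  have hwuv : w u v ≠ 0 := by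
    simp only [w, hfu]
    split_ifs <;> norm_num
  obtain ⟨m, hm, hmu, hmw⟩ := hw.exists_isMate_of_isSolid hbrick hsolid hwuv
  exact ⟨m, fun a => ⟨hw' _ _ (hmw a), (hm a).2⟩, hmu⟩

end Structure

/-! ### Uncrossing two obstructions at a vertex -/

section Uncrossing

variable {V : Type*} [Fintype V] [DecidableEq V] {G : SimpleGraph V}

/-- The obstructions to the removability of two edges `xy` and `xb` force `x` to be adjacent to
no vertices other than `y`, `b` and the vertex avoided by both obstructions. -/
theorem IsBrick.eq_of_adj_of_obstructions (hbrick : IsBrick G) {v₀ x y b : V} (hxy : G.Adj x y)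
    (hxb : G.Adj x b) (hyb : y ≠ b) {I J : Finset V} (hxI : x ∈ I)
    (hI : ∀ a ∈ I, ∀ c ∈ I, G.Adj a c → s(a, c) = s(x, y)) (hIc : #(outer G I) ≤ #I)
    (hxJ : x ∈ J) (hJ : ∀ a ∈ J, ∀ c ∈ J, G.Adj a c → s(a, c) = s(x, b))
    (hJc : #(outer G J) ≤ #J) (hvI : v₀ ∉ I) (hvJ : v₀ ∉ J) {w : V} (hxw : G.Adj x w) :
    w = y ∨ w = b ∨ w = v₀ := by
  classical
  obtain ⟨m, hm⟩ := hbrick.1.exists_isMate_self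
  have heven := even_card hm
  set B := outer G I with hB
  set C := outer G J with hC
  have hIB : ∀ a ∈ I, ∀ c, G.Adj a c → c ∈ I ∨ c ∈ B := fun a ha c hac =>
    or_iff_not_imp_left.2 fun h => mem_outer.2 ⟨h, a, ha, hac⟩
  have hJC : ∀ a ∈ J, ∀ c, G.Adj a c → c ∈ J ∨ c ∈ C := fun a ha c hac =>
    or_iff_not_imp_left.2 fun h => mem_outer.2 ⟨h, a, ha, hac⟩
  have hBI : ∀ a ∈ B, a ∉ I := fun a ha => (mem_outer.1 ha).1
  have hCJ : ∀ a ∈ C, a ∉ J := fun a ha => (mem_outer.1 ha).1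
  have hI' : ∀ a ∈ I, ∀ c ∈ I, G.Adj a c → (a = x ∧ c = y) ∨ (a = y ∧ c = x) :=
    fun a ha c hc hac => Sym2.eq_iff.1 (hI a ha c hc hac)
  have hJ' : ∀ a ∈ J, ∀ c ∈ J, G.Adj a c → (a = x ∧ c = b) ∨ (a = b ∧ c = x) :=
    fun a ha c hc hac => Sym2.eq_iff.1 (hJ a ha c hc hac)
  have hyC : y ∈ C := by
    refine (hJC x hxJ y hxy).resolve_left fun h => ?_
    rcases hJ' x hxJ y h hxy with h | h
    exacts [hyb h.2, hxb.ne h.1]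
  have hbB : b ∈ B := by
    refine (hIB x hxI b hxb).resolve_left fun h => ?_
    rcases hI' x hxI b h hxb with h | h
    exacts [hyb h.2.symm, hxy.ne h.1]
  -- `S` and `T` are stable. Apart from `y` and `b`, the neighbours of `S` lie in `B ∩ C` and those
  -- of `T` in `P`.
  set S := I ∩ J with hS
  set T := (I ∪ J) \ (B ∪ C) with hT
  set P := (B ∪ C) \ (I ∪ J) with hP
  have mS : ∀ a, a ∈ S ↔ a ∈ I ∧ a ∈ J := fun a => by simp [hS]
  have mT : ∀ a, a ∈ T ↔ (a ∈ I ∨ a ∈ J) ∧ a ∉ B ∧ a ∉ C := fun a => by simp [hT]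
  have mP : ∀ a, a ∈ P ↔ (a ∈ B ∨ a ∈ C) ∧ a ∉ I ∧ a ∉ J := fun a => by simp [hP]
  have mBC : ∀ a, a ∈ B ∩ C ↔ a ∈ B ∧ a ∈ C := fun a => mem_inter
  have hxS : x ∈ S := (mS x).2 ⟨hxI, hxJ⟩
  have hST : S ⊆ T := fun a ha => by grind
  have hxT : x ∈ T := hST hxS
  have hindT : ∀ a ∈ T, ∀ c ∈ T, ¬ G.Adj a c := by
    intro a ha c hc hac
    have := hac.symm
    grind
  have hindS : ∀ a ∈ S, ∀ c ∈ S, ¬ G.Adj a c := fun a ha c hc => hindT a (hST ha) c (hST hc)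
  have hBC_P : B ∩ C ⊆ P := fun a ha => by grind
  -- With `#B ≤ #I` and `#C ≤ #J` this gives `#(B ∩ C) + #P ≤ #S + #T`; the two bounds that follow
  -- force equality throughout.
  have hsum : #B + #C + #S + #T = #I + #J + #(B ∩ C) + #P := by
    have h1 := card_union_add_card_inter B C
    have h2 := card_union_add_card_inter I J
    have h3 := card_sdiff_add_card_inter (B ∪ C) (I ∪ J)
    have h4 := card_sdiff_add_card_inter (I ∪ J) (B ∪ C)
    rw [inter_comm, ← hT] at h4
    rw [← hP] at h3
    rw [← hS] at h2
    omega
  have hS2 : #S ≤ #(B ∩ C) := by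
    have h1 := hbrick.card_add_two_le_card_outer ⟨x, hxS⟩ hindS
    have h2 : outer G S ⊆ insert y (insert b (B ∩ C)) := by
      intro q hq
      obtain ⟨hqS, a, ha, haq⟩ := mem_outer.1 hq
      rw [mem_insert, mem_insert]
      grind
    have := (card_le_card h2).trans ((card_insert_le _ _).trans
      (Nat.succ_le_succ (card_insert_le _ _)))
    omega
  have hT2 : #T ≤ #P := by
    have h1 := hbrick.card_add_two_le_card_outer ⟨x, hxT⟩ hindT
    have h2 : outer G T ⊆ insert y (insert b P) := by
      intro q hq
      obtain ⟨hqS, a, ha, haq⟩ := mem_outer.1 hq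
      have := haq.symm
      rw [mem_insert, mem_insert]
      grind
    have := (card_le_card h2).trans ((card_insert_le _ _).trans
      (Nat.succ_le_succ (card_insert_le _ _)))
    omega
  -- Without `x` the exceptional neighbours `y` and `b` disappear, so a nonempty remainder would
  -- expand too much for equality. The same holds for `T`.
  have hSx : S.erase x = ∅ := by
    rw [← not_nonempty_iff_eq_empty]
    intro hne
    have h1 := hbrick.card_add_two_le_card_outer hne fun a ha c hc =>
      hindS a (mem_of_mem_erase ha) c (mem_of_mem_erase hc)
    have h2 : outer G (S.erase x) ⊆ B ∩ C := by
      intro q hq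
      obtain ⟨hqS, a, ha, haq⟩ := mem_outer.1 hq
      have := hindS a (mem_of_mem_erase ha) q
      rw [mem_erase] at ha hqS
      grind
    have h3 := card_le_card h2
    have h4 := card_erase_add_one hxS
    omega
  have hTx : T.erase x = ∅ := by
    rw [← not_nonempty_iff_eq_empty]
    intro hne
    have h1 := hbrick.card_add_two_le_card_outer hne fun a ha c hc =>
      hindT a (mem_of_mem_erase ha) c (mem_of_mem_erase hc)
    have h2 : outer G (T.erase x) ⊆ P := by
      intro q hq
      obtain ⟨hqT, a, ha, haq⟩ := mem_outer.1 hq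
      have := hindT a (mem_of_mem_erase ha) q
      have := haq.symm
      rw [mem_erase] at ha hqT
      grind
    have h3 := card_le_card h2
    have h4 := card_erase_add_one hxT
    omega
  have hTx' : ∀ a ∈ T, a = x := fun a ha => by
    by_contra h
    have : a ∈ T.erase x := mem_erase.2 ⟨h, ha⟩
    rw [hTx] at this
    exact notMem_empty _ this
  have hS1 := card_erase_add_one hxS
  have hT1 := card_erase_add_one hxT
  rw [hSx, card_empty] at hS1
  rw [hTx, card_empty] at hT1
  have hPBC : B ∩ C = P := eq_of_subset_of_card_le hBC_P (by omega)
  obtain ⟨z, hz⟩ := card_eq_one.1 (show #(B ∩ C) = 1 by omega)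
  have hzP : ∀ a, a ∈ P → a = z := fun a ha => by rwa [← hPBC, hz, mem_singleton] at ha
  have hzBC : z ∈ B ∧ z ∈ C := by
    rw [← mBC, hz]
    exact mem_singleton_self z
  -- Vertices outside `I ∪ B` attach to the rest only at `z`, so their number would be odd; but `#B
  -- = #I` makes it even.
  have hcover : ∀ a, a ∈ I ∨ a ∈ B := by
    by_contra! hcon
    obtain ⟨r, hrI, hrB⟩ := hcon
    set R := univ \ (I ∪ B) with hR
    have mR : ∀ a, a ∈ R ↔ a ∉ I ∧ a ∉ B := fun a => by simp [hR]
    have hRJ : ∀ a ∈ R, a ∉ J ∧ a ∉ C := by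
      intro a ha
      obtain ⟨haI, haB⟩ := (mR a).1 ha
      have haJ : a ∉ J := fun h =>
        haI (hTx' a ((mT a).2 ⟨Or.inr h, haB, fun h' => hCJ a h' h⟩) ▸ hxI)
      exact ⟨haJ, fun h => haB (hzP a ((mP a).2 ⟨Or.inr h, haI, haJ⟩) ▸ hzBC.1)⟩
    have hodd : Odd #R := by
      refine hbrick.1.odd_card_of_cutVertex ⟨r, (mR r).2 ⟨hrI, hrB⟩⟩ (z := z)
        (fun h => ((mR z).1 h).2 hzBC.1) fun a ha q haq => ?_
      obtain ⟨haI, haB⟩ := (mR a).1 ha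
      obtain ⟨haJ, haC⟩ := hRJ a ha
      have hqI : q ∉ I := fun h => (hIB q h a haq.symm).elim haI haB
      have hqJ : q ∉ J := fun h => (hJC q h a haq.symm).elim haJ haC
      by_cases hqB : q ∈ B
      · exact Or.inr (hzP q ((mP q).2 ⟨Or.inl hqB, hqI, hqJ⟩))
      · exact Or.inl ((mR q).2 ⟨hqI, hqB⟩)
    have h1 : #R + #(I ∪ B) = Fintype.card V := by
      rw [hR, card_sdiff_add_card_eq_card (subset_univ _), card_univ]
    rw [card_union_of_disjoint (Finset.disjoint_right.2 hBI)] at h1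
    have : #B = #I := by omega
    grind
  have hvz : v₀ = z :=
    hzP v₀ ((mP v₀).2 ⟨Or.inl ((hcover v₀).resolve_left hvI), hvI, hvJ⟩)
  rw [hvz]
  by_cases hwI : w ∈ I
  · rcases hI' x hxI w hwI hxw with h | h
    exacts [Or.inl h.2, absurd h.1 hxy.ne]
  by_cases hwJ : w ∈ J
  · rcases hJ' x hxJ w hwJ hxw with h | h
    exacts [Or.inr (Or.inl h.2), absurd h.1 hxb.ne]
  exact Or.inr (Or.inr (hzP w ((mP w).2 ⟨Or.inl ((hcover w).resolve_left hwI), hwI, hwJ⟩)))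

end Uncrossing

/-! ### Obstructions avoid `v₀` -/

section VertexMatching

theorem ncard_inter_incidenceSet {V : Type*} {G : SimpleGraph V} {M : Set (Sym2 V)}
    (hM : M ⊆ G.edgeSet) (v : V) :
    (M ∩ G.incidenceSet v).ncard = {b | s(v, b) ∈ M}.ncard := by
  have : M ∩ G.incidenceSet v = (fun b => s(v, b)) '' {b | s(v, b) ∈ M} := by
    ext e
    constructor
    · rintro ⟨heM, -, hv⟩
      obtain ⟨b, rfl⟩ := Sym2.mem_iff_exists.1 hv
      exact ⟨b, heM, rfl⟩
    · rintro ⟨b, hb, rfl⟩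
      exact ⟨hb, hM hb, Sym2.mem_mk_left v b⟩
  rw [this, Set.ncard_image_of_injective]
  exact fun a b h => Sym2.congr_right.1 h

variable {V : Type*} [Fintype V] [DecidableEq V] {G : SimpleGraph V}

/-- As `xy ∉ M`, no edge of `M` lies inside `I`. If `v₀ ∈ I`, two partners of `v₀` and the distinct
partners of the other vertices of `I` give `#I + 1` outside neighbours. -/
theorem IsVertexMatching.notMem_of_obstruction {v₀ : V} {M : Set (Sym2 V)}
    (hM : IsVertexMatching G v₀ M) {x y : V} (hxy : s(x, y) ∉ M) {I : Finset V}
    (hI : ∀ a ∈ I, ∀ b ∈ I, G.Adj a b → s(a, b) = s(x, y)) (hIc : #(outer G I) ≤ #I) :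
    v₀ ∉ I := by
  intro hv
  obtain ⟨hMG, hM1, hM2⟩ := hM
  have huniq : ∀ a, a ≠ v₀ → ∃ b, {b | s(a, b) ∈ M} = {b} := by
    intro a ha
    rw [← Set.ncard_eq_one, ← ncard_inter_incidenceSet hMG]
    exact hM1 a ha
  rw [ncard_inter_incidenceSet hMG, Set.one_lt_ncard_iff] at hM2
  obtain ⟨p, q, hp, hq, hpq⟩ := hM2
  have : Nonempty V := ⟨v₀⟩
  choose! ν hν using huniq
  have hνM : ∀ a, a ≠ v₀ → s(a, ν a) ∈ M := fun a ha => by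
    have : ν a ∈ {b | s(a, b) ∈ M} := by rw [hν a ha]; rfl
    exact this
  have hνu : ∀ a, a ≠ v₀ → ∀ b, s(a, b) ∈ M → b = ν a := fun a ha b hb => by
    have : b ∈ {b | s(a, b) ∈ M} := hb
    rwa [hν a ha] at this
  have hout : ∀ a ∈ I, ∀ b, s(a, b) ∈ M → b ∈ outer G I := by
    intro a ha b hab
    have hadj : G.Adj a b := hMG hab
    refine mem_outer.2 ⟨fun hb => hxy ?_, a, ha, hadj⟩
    rwa [← hI a ha b hb hadj]
  have hne : ∀ b ∈ outer G I, b ≠ v₀ := fun b hb h => (mem_outer.1 hb).1 (h ▸ hv)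
  have hpO := hout v₀ hv p hp
  have hqO := hout v₀ hv q hq
  have hback : ∀ a ∈ I, ∀ b, s(a, b) ∈ M → a = ν b := fun a ha b hab =>
    hνu b (hne b (hout a ha b hab)) a (by rwa [Sym2.eq_swap])
  have hsub : insert p (insert q ((I.erase v₀).image ν)) ⊆ outer G I := by
    intro b hb
    rw [mem_insert, mem_insert, mem_image] at hb
    rcases hb with rfl | rfl | ⟨a, ha, rfl⟩
    · exact hpO
    · exact hqO
    · obtain ⟨hav, ha⟩ := mem_erase.1 ha
      exact hout a ha _ (hνM a hav)
  have hnotin : ∀ b, s(v₀, b) ∈ M → b ∉ (I.erase v₀).image ν := by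
    intro b hb h
    obtain ⟨a, ha, rfl⟩ := mem_image.1 h
    obtain ⟨hav, ha⟩ := mem_erase.1 ha
    exact hav ((hback a ha _ (hνM a hav)).trans (hback v₀ hv _ hb).symm)
  have hinj : Set.InjOn ν (I.erase v₀ : Finset V) := by
    intro a ha c hc hac
    obtain ⟨hav, ha⟩ := mem_erase.1 (mem_coe.1 ha)
    obtain ⟨hcv, hc⟩ := mem_erase.1 (mem_coe.1 hc)
    rw [hback a ha _ (hνM a hav), hac, ← hback c hc _ (hνM c hcv)]
  have h1 := card_le_card hsub
  rw [card_insert_of_notMem, card_insert_of_notMem (hnotin q hq), card_image_of_injOn hinj] at h1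
  · have := card_erase_add_one hv
    omega
  · rw [mem_insert, not_or]
    exact ⟨hpq, hnotin p hp⟩

end VertexMatching

/-! ### Recognising the odd wheel -/

section Wheel

variable {V : Type*} [Fintype V] [DecidableEq V] {G : SimpleGraph V}

/-- A matching covered graph with a vertex `v₀` adjacent to all others and whose other vertices
have degree three is an odd wheel with hub `v₀`. -/
theorem IsMatchingCovered.isOddWheelWithHub (h : IsMatchingCovered G) {v₀ : V}
    (hv : ∀ x, x ≠ v₀ → G.Adj x v₀)
    (hdeg : ∀ x, x ≠ v₀ → ∃ p q, p ≠ q ∧ ∀ w, (G.Adj x w ∧ w ≠ v₀) ↔ (w = p ∨ w = q)) :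
    IsOddWheelWithHub G v₀ := by
  classical
  obtain ⟨m, hm⟩ := h.exists_isMate_self
  have heven := even_card hm
  let H : SimpleGraph V :=
    { Adj := fun a b => G.Adj a b ∧ a ≠ v₀ ∧ b ≠ v₀
      symm := ⟨fun a b hab => ⟨hab.1.symm, hab.2.2, hab.2.1⟩⟩
      loopless := ⟨fun a ha => G.irrefl ha.1⟩ }
  have hH : ∀ a b, H.Adj a b ↔ G.Adj a b ∧ a ≠ v₀ ∧ b ≠ v₀ := fun _ _ => Iff.rfl
  have hnbr : ∀ x, x ≠ v₀ → ∃ p q, p ≠ q ∧ H.neighborSet x = {p, q} := by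
    intro x hx
    obtain ⟨p, q, hpq, hw⟩ := hdeg x hx
    refine ⟨p, q, hpq, ?_⟩
    ext w
    rw [mem_neighborSet, hH, Set.mem_insert_iff, Set.mem_singleton_iff, ← hw]
    exact ⟨fun h => ⟨h.1, h.2.2⟩, fun h => ⟨h.1, hx, h.2⟩⟩
  have hcyc : H.IsCycles := by
    rintro x ⟨w, hw⟩
    obtain ⟨p, q, hpq, hx⟩ := hnbr x ((hH x w).1 hw).2.1
    rw [hx, Set.ncard_pair hpq]
  have := h.2.1
  obtain ⟨x, hx⟩ := exists_ne v₀
  obtain ⟨c, hc, -⟩ := hcyc.exists_cycle_toSubgraph_verts_eq_connectedComponentSupp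
    (c := H.connectedComponentMk x) (v := x) rfl (by
      obtain ⟨p, q, -, hx⟩ := hnbr x hx
      rw [hx]
      exact ⟨p, by simp⟩)
  have hlen := hc.three_le_length
  obtain ⟨f⟩ := (cycleGraph_isContained_iff (G := H) (n := c.length) (by omega)).2
    ⟨x, c, hc, rfl⟩
  obtain ⟨n, hn⟩ : ∃ n, c.length = n + 3 := ⟨c.length - 3, by omega⟩
  rw [hn] at f
  have hfinj : Function.Injective f := f.injective
  have hfadj : ∀ i j, (cycleGraph (n + 3)).Adj i j → H.Adj (f i) (f j) :=
    fun i j hij => f.toHom.map_adj hij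
  have hcard2 : ∀ i, #((cycleGraph (n + 3)).neighborFinset i) = 2 := fun i => by
    rw [card_neighborFinset_eq_degree]
    exact cycleGraph_degree_three_le
  have hfv : ∀ i, f i ≠ v₀ := by
    intro i
    obtain ⟨j, hj⟩ := card_pos.1 (by rw [hcard2 i]; norm_num :
      0 < #((cycleGraph (n + 3)).neighborFinset i))
    exact ((hH _ _).1 (hfadj i j (by simpa using hj))).2.1
  have hclosed : ∀ i w, H.Adj (f i) w → ∃ j, (cycleGraph (n + 3)).Adj i j ∧ f j = w := by
    intro i w hw
    obtain ⟨p, q, hpq, hN⟩ := hnbr (f i) (hfv i)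
    have h1 : ((cycleGraph (n + 3)).neighborFinset i).image f = {p, q} := by
      apply eq_of_subset_of_card_le
      · intro a ha
        obtain ⟨j, hj, rfl⟩ := mem_image.1 ha
        have : f j ∈ H.neighborSet (f i) := hfadj i j (by simpa using hj)
        rw [hN] at this
        simpa using this
      · rw [card_image_of_injective _ hfinj, hcard2, card_pair hpq]
    have h2 : w ∈ ((cycleGraph (n + 3)).neighborFinset i).image f := by
      rw [h1]
      have : w ∈ H.neighborSet (f i) := hw
      rw [hN] at this
      simpa using this
    obtain ⟨j, hj, rfl⟩ := mem_image.1 h2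
    exact ⟨j, by simpa using hj, rfl⟩
  set R := univ.image f with hR
  have hvR : v₀ ∉ R := by
    intro hv
    obtain ⟨i, -, hi⟩ := mem_image.1 hv
    exact hfv i hi
  have hRcl : ∀ a ∈ R, ∀ b, H.Adj a b → b ∈ R := by
    intro a ha b hab
    obtain ⟨i, -, rfl⟩ := mem_image.1 ha
    obtain ⟨j, -, rfl⟩ := hclosed i b hab
    exact mem_image_of_mem f (mem_univ j)
  have hRodd : Odd #R := by
    refine h.odd_card_of_cutVertex ⟨f 0, mem_image_of_mem f (mem_univ 0)⟩ hvR fun a ha b hab => ?_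
    rw [or_iff_not_imp_right]
    exact fun hb => hRcl a ha b ⟨hab, fun h => hvR (h ▸ ha), hb⟩
  have hRcard : #R = n + 3 := by
    rw [hR, card_image_of_injective _ hfinj, card_univ, Fintype.card_fin]
  have hall : ∀ a, a ≠ v₀ → a ∈ R := by
    by_contra! hcon
    obtain ⟨r, hrv, hrR⟩ := hcon
    -- Vertices off the cycle would also form an odd set cut off by `v₀`; together with the odd `R`
    -- and `v₀` itself, `V` would be odd.
    have hodd : Odd #(insert v₀ R)ᶜ := by
      refine h.odd_card_of_cutVertex (z := v₀) ⟨r, by simp [hrv, hrR]⟩ (by simp) fun a ha b hab => ?_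
      rw [mem_compl, mem_insert, not_or] at ha
      rw [or_iff_not_imp_right, mem_compl, mem_insert, not_or]
      exact fun hb => ⟨hb, fun hbR => ha.2 (hRcl b hbR a ⟨hab.symm, hb, ha.1⟩)⟩
    have h1 := card_add_card_compl (insert v₀ R)
    rw [card_insert_of_notMem hvR] at h1
    rw [Nat.odd_iff] at hodd hRodd
    rw [Nat.even_iff] at heven
    omega
  let g : Option (Fin (n + 3)) → V := fun o => o.elim v₀ f
  have hg : Function.Bijective g := by
    constructor
    · rintro (_ | i) (_ | j) hij
      · rfl
      · exact absurd hij.symm (hfv j)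
      · exact absurd hij (hfv i)
      · exact congrArg some (hfinj hij)
    · intro a
      by_cases ha : a = v₀
      · exact ⟨none, ha.symm⟩
      · obtain ⟨i, -, hi⟩ := mem_image.1 (hall a ha)
        exact ⟨some i, hi⟩
  let ψ : wheel (n + 3) ≃g G :=
    { toEquiv := Equiv.ofBijective g hg
      map_rel_iff' := by
        rintro (_ | i) (_ | j)
        · exact ⟨fun h => absurd h (G.irrefl), fun h => h.elim⟩
        · exact ⟨fun _ => trivial, fun _ => (hv _ (hfv j)).symm⟩
        · exact ⟨fun _ => trivial, fun _ => hv _ (hfv i)⟩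
        · refine ⟨fun hij => ?_, fun hij => (hfadj i j hij).1⟩
          obtain ⟨k, hk, hkj⟩ := hclosed i (f j) ⟨hij, hfv i, hfv j⟩
          exact hfinj hkj ▸ hk }
  refine ⟨n + 3, hRcard ▸ hRodd, by omega, ψ.symm, ?_⟩
  rw [RelIso.symm_apply_eq]
  rfl

end Wheel

end OddWheelLemma

/-! ### The local structure at each vertex other than `v₀` -/

open Finset OddWheelLemma in
theorem lemma1p18 {V : Type*} [Finite V] (G : SimpleGraph V)
    (hbrick : OddWheelLemma.IsBrick G) (hsolid : OddWheelLemma.IsSolid G)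
    (v₀ : V) (M₀ : Set (Sym2 V)) (hM₀ : OddWheelLemma.IsVertexMatching G v₀ M₀) :
    OddWheelLemma.IsOddWheelWithHub G v₀ ∨
      ∃ e, OddWheelLemma.IsRemovable G e ∧ e ∉ M₀ ∪ OddWheelLemma.cut G {v₀} := by
  classical
  have := Fintype.ofFinite V
  rw [or_iff_not_imp_right]
  intro hno
  push Not at hno
  have hobs : ∀ x y, G.Adj x y → x ≠ v₀ → y ≠ v₀ → s(x, y) ∉ M₀ →
      ∃ I : Finset V, x ∈ I ∧ y ∈ I ∧ (∀ a ∈ I, ∀ b ∈ I, G.Adj a b → s(a, b) = s(x, y)) ∧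
        #(outer G I) ≤ #I ∧ v₀ ∉ I := by
    intro x y hxy hx hy hM
    obtain ⟨I, hxI, hyI, hI, hIc⟩ := exists_obstruction hbrick hsolid hxy (fun hr => by
      rcases hno _ hr with h | ⟨a, ha, b, -, -, he⟩
      · exact hM h
      · rw [Set.mem_singleton_iff] at ha
        subst ha
        rcases Sym2.eq_iff.1 he with h | h
        exacts [hx h.1, hy h.2])
    exact ⟨I, hxI, hyI, hI, hIc, hM₀.notMem_of_obstruction hM hI hIc⟩
  have hkey : ∀ x, x ≠ v₀ → G.Adj x v₀ ∧
      ∃ p q, p ≠ q ∧ ∀ w, (G.Adj x w ∧ w ≠ v₀) ↔ (w = p ∨ w = q) := by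
    intro x hx
    set N := outer G {x} with hN
    have mN : ∀ w, w ∈ N ↔ G.Adj x w := by
      intro w
      simp only [hN, mem_outer, mem_singleton, exists_eq_left]
      exact ⟨fun h => h.2, fun h => ⟨h.ne', h⟩⟩
    have hN3 : 3 ≤ #N := by
      simpa using hbrick.card_add_two_le_card_outer (singleton_nonempty x) (by simp)
    have hle : #(N.erase v₀) ≤ 2 := by
      obtain ⟨μ, hμ⟩ := Set.ncard_eq_one.1
        ((ncard_inter_incidenceSet hM₀.1 x).symm.trans (hM₀.2.1 x hx))
      have hμ' : ∀ b, s(x, b) ∈ M₀ → b = μ := fun b hb => by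
        have : b ∈ {b | s(x, b) ∈ M₀} := hb
        rwa [hμ] at this
      by_contra! hlt
      -- Three neighbours besides `v₀` leave two, `y` and `b`, that differ from the `M₀`-partner
      -- `μ`; both edges then have obstructions avoiding `v₀`.
      have h1 := pred_card_le_card_erase (s := N.erase v₀) (a := μ)
      obtain ⟨y, hy, b, hb, hyb⟩ := one_lt_card.1 (show 1 < #((N.erase v₀).erase μ) by omega)
      simp only [mem_erase, mN] at hy hb
      obtain ⟨I, hxI, -, hI, hIc, hvI⟩ :=
        hobs x y hy.2.2 hx hy.2.1 fun h => hy.1 (hμ' y h)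
      obtain ⟨J, hxJ, -, hJ, hJc, hvJ⟩ :=
        hobs x b hb.2.2 hx hb.2.1 fun h => hb.1 (hμ' b h)
      have hsub : N.erase v₀ ⊆ {y, b} := by
        intro w hw
        rw [mem_erase, mN] at hw
        rw [mem_insert, mem_singleton]
        rcases hbrick.eq_of_adj_of_obstructions hy.2.2 hb.2.2 hyb hxI hI hIc hxJ hJ hJc
          hvI hvJ hw.2 with h | h | h
        exacts [Or.inl h, Or.inr h, absurd h hw.1]
      have := (card_le_card hsub).trans card_le_two
      omega
    have hvN : v₀ ∈ N := by
      by_contra h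
      rw [erase_eq_of_notMem h] at hle
      omega
    have h2 := card_erase_add_one hvN
    obtain ⟨p, q, hpq, he⟩ := card_eq_two.1 (show #(N.erase v₀) = 2 by omega)
    refine ⟨(mN v₀).1 hvN, p, q, hpq, fun w => ?_⟩
    rw [← mN, and_comm, ← mem_erase, he, mem_insert, mem_singleton]
  exact hbrick.1.isOddWheelWithHub (fun x hx => (hkey x hx).1) fun x hx => (hkey x hx).2
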